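/- For complex $a,q$ write $(a;q)_n=\prod_{j=1}^{n}(1-aq^{j-1})$ and, for $|q|<1$, $(a;q)_\infty=\lim_{n\to\infty}(a;q)_n$. Let $k$ be a positive integer, and for integers $n_k,\ldots,n_1$ put $N=kn_k+(k-1)n_{k-1}+\cdots+2n_2+n_1$. There is exactly one family of polynomials $b(n_k,\ldots,n_1)\in\mathbb{Z}[q]$, indexed by all $(n_k,\ldots,n_1)\in\mathbb{Z}^k$, such that $b(0,\ldots,0)=1$, $b(n_k,\ldots,n_1)=0$ if $n_j<0$ for some $j$, and, for all nonnegative $n_k,\ldots,n_1$ that are not all zero, $$b(n_k,\ldots,n_1)=\sum_{j=1}^{k}\ \Bigl(\prod_{r=2}^{j}\bigl(1+q+q^2+\cdots+q^{N-r}\bigr)\Bigr)\,q^{(k-j)n_k+(k-1-j)n_{k-1}+\cdots+2n_{j+2}+n_{j+1}}\;b(n_k,\ldots,n_{j+1},n_j-1,n_{j-1},\ldots,n_1),$$ where the product is $1$ for $j=1$ and a sum $1+q+\cdots+q^{e}$ with $e<0$ is $0$; if some $n_j=0$, the corresponding summand is $0$. For this family, and for all complex $q,x$ with $|q|<1$ and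 $xq^m\neq 1$ for every $m\ge 1$, both infinite products below converge, the denominator $(xq;q)_\infty$ is nonzero, the $k$-fold series converges absolutely, and $$\frac{(x^{k+1}q^{k+1};q^{k+1})_\infty}{(xq;q)_\infty}=\sum_{n_k,\ldots,n_1\ge 0}\frac{q^{\binom{n_k+n_{k-1}+\cdots+n_1+1}{2}+\binom{n_k+n_{k-1}+\cdots+n_2+1}{2}+\cdots+\binom{n_k+1}{2}}\,(1-q)^{(k-1)n_k+(k-2)n_{k-1}+\cdots+2n_3+n_2}}{(q;q)_{kn_k+(k-1)n_{k-1}+\cdots+2n_2+n_1}}\;x^{kn_k+(k-1)n_{k-1}+\cdots+2n_2+n_1}\;b(n_k,\ldots,n_1).$$ -/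

import Mathlib

open Polynomial

/-- The finite `q`-Pochhammer symbol `(a; q)_n = ∏_{j=1}^{n} (1 - a q^{j-1})`. -/
noncomputable def qPoch (a q : ℂ) (n : ℕ) : ℂ :=
  ∏ j ∈ Finset.range n, (1 - a * q ^ j)

/-- The infinite `q`-Pochhammer symbol `(a; q)_∞ = ∏_{j ≥ 1} (1 - a q^{j-1})`. -/
noncomputable def qPochInf (a q : ℂ) : ℂ :=
  ∏' j : ℕ, (1 - a * q ^ j)

/- Throughout, a tuple `n` indexed by `Fin k` stands for `(n_k, …, n_1)`,
with `n i` (for `i = 0, …, k - 1`) standing for `n_{i+1}`. -/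

/-- The number of parts `k n_k + (k-1) n_{k-1} + ⋯ + 2 n_2 + n_1`, for an integer tuple. -/
def partCountInt {k : ℕ} (n : Fin k → ℤ) : ℤ :=
  ∑ i : Fin k, ((i : ℤ) + 1) * n i

/-- The `q`-analogue sum `1 + q + ⋯ + q^e`, as a polynomial in `q` (empty, so `0`, if `e < 0`). -/
noncomputable def geomPoly (e : ℤ) : ℤ[X] :=
  ∑ d ∈ Finset.range (e + 1).toNat, X ^ d

/-- The conditions that define the polynomials `b(n_k, …, n_1)` in `q` (the variable `X`), for
all integers `n_k, …, n_1`. In the recurrence the summand of `j` belongs to lowering `n_{j+1}`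
by one; its geometric factors have the top exponents `N - 2, N - 3, …, N - (j + 1)`, where
`N = k n_k + ⋯ + n_1`, and its power of `q` has the exponent `∑_{i > j} (i - j) n_{i+1}`. -/
structure IsRegularCoeff (k : ℕ) (b : (Fin k → ℤ) → ℤ[X]) : Prop where
  zero : b 0 = 1
  neg : ∀ n : Fin k → ℤ, (∃ i, n i < 0) → b n = 0
  recurrence : ∀ n : Fin k → ℤ, (∀ i, 0 ≤ n i) → n ≠ 0 →
    b n = ∑ j : Fin k,
      (∏ r ∈ Finset.Icc 2 ((j : ℕ) + 1), geomPoly (partCountInt n - (r : ℤ))) *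
        X ^ (∑ i ∈ Finset.Ioi j, ((i : ℤ) - (j : ℤ)) * n i).toNat *
        b (n - Pi.single j 1)

/-- The number of parts `k n_k + (k-1) n_{k-1} + ⋯ + 2 n_2 + n_1`. -/
def partCount {k : ℕ} (n : Fin k → ℕ) : ℕ :=
  ∑ i : Fin k, ((i : ℕ) + 1) * n i

/-- The exponent `binom(n_k + ⋯ + n_1 + 1, 2) + binom(n_k + ⋯ + n_2 + 1, 2) + ⋯ +
binom(n_k + 1, 2)`. -/
def triangularExponent {k : ℕ} (n : Fin k → ℕ) : ℕ :=
  ∑ i : Fin k, ((∑ l ∈ Finset.Ici i, n l) + 1).choose 2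

/-- The exponent `(k-1) n_k + (k-2) n_{k-1} + ⋯ + 2 n_3 + n_2`. -/
def excessExponent {k : ℕ} (n : Fin k → ℕ) : ℕ :=
  ∑ i : Fin k, (i : ℕ) * n i

/-- The summand of index `(n_k, …, n_1)` of the multiple series. -/
noncomputable def regularTerm {k : ℕ} (b : (Fin k → ℤ) → ℤ[X]) (x q : ℂ) (n : Fin k → ℕ) : ℂ :=
  q ^ triangularExponent n * (1 - q) ^ excessExponent n / qPoch q q (partCount n) *
    x ^ partCount n * aeval q (b fun i => (n i : ℤ))

/-! Let `F(x)` be the series, `N` the weight `partCount n`, and write `j` for the zero-based index.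
Multiplying the term of index `n` by `1 - q^N` and expanding `b` by its recurrence, the summand of
`j` becomes `(xq)^(j+1)` times the term of index `n - e_j` at `xq` (`recurrence_summand`). Summing
over `n` gives `F(x) = (1 + xq + ⋯ + (xq)^k) F(xq)` (`tsum_regularTerm_eq`). Each geometric sum is a
quotient `(1 - y^(k+1)) / (1 - y)`, so iteration produces the two finite products
(`qPoch_mul_tsum`), and `F(x q^M) → 1` gives the identity. Convergence holds because `b` grows at
most exponentially in the sum of the entries, while the exponent of `q` grows quadratically. -/

/-! ### Existence and uniqueness of the coefficients -/

section Existence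

variable {k : ℕ}

/-- The right-hand side of the recurrence, applied to an arbitrary family `f`. -/
noncomputable def recurrenceSum (f : (Fin k → ℤ) → ℤ[X]) (n : Fin k → ℤ) : ℤ[X] :=
  ∑ j : Fin k,
    (∏ r ∈ Finset.Icc 2 ((j : ℕ) + 1), geomPoly (partCountInt n - (r : ℤ))) *
      X ^ (∑ i ∈ Finset.Ioi j, ((i : ℤ) - (j : ℤ)) * n i).toNat *
      f (n - Pi.single j 1)

open Classical in
/-- The coefficients `b(n)` for tuples whose entries sum to `s`. -/
noncomputable def coeffOfSum : ℕ → (Fin k → ℤ) → ℤ[X]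
  | 0, n => if n = 0 then 1 else 0
  | s + 1, n => if ∀ i, 0 ≤ n i then recurrenceSum (coeffOfSum s) n else 0

theorem coeffOfSum_eq_zero (s : ℕ) (n : Fin k → ℤ) (h : ∃ i, n i < 0) : coeffOfSum s n = 0 := by
  obtain ⟨i, hi⟩ := h
  cases s with
  | zero => exact if_neg fun h0 => by simp [h0] at hi
  | succ s => exact if_neg fun h0 => absurd (h0 i) (by omega)

theorem sum_sub_single (n : Fin k → ℤ) (j : Fin k) :
    ∑ i, (n - Pi.single j 1 : Fin k → ℤ) i = ∑ i, n i - 1 := by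
  simp [Finset.sum_sub_distrib]

theorem sum_pos_of_ne_zero (n : Fin k → ℤ) (h : ∀ i, 0 ≤ n i) (h0 : n ≠ 0) : 0 < ∑ i, n i := by
  obtain ⟨i, hi⟩ := Function.ne_iff.mp h0
  exact Finset.sum_pos' (fun i _ => h i) ⟨i, Finset.mem_univ i, lt_of_le_of_ne (h i) (Ne.symm hi)⟩

theorem exists_isRegularCoeff (k : ℕ) : ∃ b : (Fin k → ℤ) → ℤ[X], IsRegularCoeff k b := by
  -- Each use of the recurrence lowers the entry sum by exactly one, so that sum drives the
  -- recursion. `toNat` sends negative sums to level `0`, where only the zero tuple has a nonzero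
  -- value.
  refine ⟨fun n => coeffOfSum (∑ i, n i).toNat n, ?_, ?_, ?_⟩
  · simp [coeffOfSum]
  · exact fun n hn => coeffOfSum_eq_zero _ n hn
  · intro n hn h0
    have hpos := sum_pos_of_ne_zero n hn h0
    obtain ⟨s, hs⟩ : ∃ s, (∑ i, n i).toNat = s + 1 := ⟨(∑ i, n i).toNat - 1, by omega⟩
    have hs' : ∀ j, (∑ i, (n - Pi.single j 1 : Fin k → ℤ) i).toNat = s := by
      intro j
      rw [sum_sub_single]
      omega
    simp only [hs, hs']
    exact if_pos hn

theorem IsRegularCoeff.ext {b c : (Fin k → ℤ) → ℤ[X]} (hb : IsRegularCoeff k b)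
    (hc : IsRegularCoeff k c) : b = c := by
  have key : ∀ (s : ℕ) (n : Fin k → ℤ), (∑ i, n i).toNat = s → b n = c n := by
    intro s
    induction s with
    | zero =>
      intro n hn
      by_cases h : ∀ i, 0 ≤ n i
      · by_cases h0 : n = 0
        · rw [h0, hb.zero, hc.zero]
        · have := sum_pos_of_ne_zero n h h0
          omega
      · push Not at h
        rw [hb.neg n h, hc.neg n h]
    | succ s ih =>
      intro n hn
      by_cases h : ∀ i, 0 ≤ n i
      · have h0 : n ≠ 0 := by
          rintro rfl
          simp at hn
        rw [hb.recurrence n h h0, hc.recurrence n h h0]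
        refine Finset.sum_congr rfl fun j _ => ?_
        rw [ih]
        rw [sum_sub_single]
        omega
      · push Not at h
        rw [hb.neg n h, hc.neg n h]
  exact funext fun n => key _ n rfl

end Existence

/-! ### Exponents under raising one entry -/

section Statistics

variable {k : ℕ}

theorem partCount_add_single (m : Fin k → ℕ) (j : Fin k) :
    partCount (m + Pi.single j 1) = partCount m + (j + 1) := by
  simp [partCount, mul_add, Finset.sum_add_distrib, Pi.single_apply]

theorem excessExponent_add_single (m : Fin k → ℕ) (j : Fin k) :
    excessExponent (m + Pi.single j 1) = excessExponent m + j := by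
  simp [excessExponent, mul_add, Finset.sum_add_distrib, Pi.single_apply]

theorem partCountInt_natCast (n : Fin k → ℕ) :
    partCountInt (fun i => (n i : ℤ)) = (partCount n : ℤ) := by
  simp [partCountInt, partCount]

theorem sum_tails_eq_partCount (n : Fin k → ℕ) :
    ∑ i, ∑ l ∈ Finset.Ici i, n l = partCount n := by
  rw [Finset.sum_comm' (t' := Finset.univ) (s' := fun l => Finset.Iic l) (by simp)]
  simp [partCount]

theorem sum_tails_Ioi (n : Fin k → ℕ) (j : Fin k) :
    ∑ i ∈ Finset.Ioi j, ∑ l ∈ Finset.Ici i, n l = ∑ l ∈ Finset.Ioi j, ((l : ℕ) - j) * n l := by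
  rw [Finset.sum_comm' (t' := Finset.Ioi j) (s' := fun l => Finset.Ioc j l)]
  · simp
  · intro x y
    simp only [Finset.mem_Ioi, Finset.mem_Ici, Finset.mem_Ioc]
    constructor
    · rintro ⟨h1, h2⟩; exact ⟨⟨h1, h2⟩, h1.trans_le h2⟩
    · rintro ⟨h1, h2⟩; exact h1

theorem toNat_sum_Ioi (n : Fin k → ℕ) (j : Fin k) :
    (∑ i ∈ Finset.Ioi j, ((i : ℤ) - (j : ℤ)) * (n i : ℤ)).toNat =
      ∑ i ∈ Finset.Ioi j, ∑ l ∈ Finset.Ici i, n l := by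
  rw [sum_tails_Ioi, ← Int.toNat_natCast (∑ l ∈ Finset.Ioi j, ((l : ℕ) - j) * n l)]
  congr 1
  push_cast
  refine Finset.sum_congr rfl fun i hi => ?_
  have : (j : ℕ) ≤ i := (Finset.mem_Ioi.mp hi).le
  push_cast [this]
  ring

/-- Raising entry `j` raises exactly the tail sums `S_i` with `i ≤ j`, and each `binom(S_i + 1, 2)`
then grows by the new `S_i`. The added sum supplies the `S_i` with `i > j`, and all tails together
give the weight. This is why the recurrence carries that power of `q`: what remains is `q^N`, which
turns `x^N` into `(xq)^N`. -/
theorem triangularExponent_add_single (m : Fin k → ℕ) (j : Fin k) :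
    triangularExponent (m + Pi.single j 1) +
        ∑ i ∈ Finset.Ioi j, ∑ l ∈ Finset.Ici i, (m + Pi.single j 1 : Fin k → ℕ) l =
      triangularExponent m + partCount (m + Pi.single j 1) := by
  have hS : ∀ i : Fin k, ∑ l ∈ Finset.Ici i, (m + Pi.single j 1 : Fin k → ℕ) l =
      (∑ l ∈ Finset.Ici i, m l) + if i ≤ j then 1 else 0 := by
    intro i
    simp [Finset.sum_add_distrib, Pi.single_apply]
  rw [← sum_tails_eq_partCount, triangularExponent, triangularExponent,
    ← Finset.filter_lt_eq_Ioi, Finset.sum_filter, ← Finset.sum_add_distrib,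
    ← Finset.sum_add_distrib]
  refine Finset.sum_congr rfl fun i _ => ?_
  rw [hS]
  by_cases h : i ≤ j
  · simp only [h, if_true, not_lt.mpr h, if_false]
    have hc := Nat.choose_succ_succ' ((∑ l ∈ Finset.Ici i, m l) + 1) 1
    simp only [Nat.choose_one_right, Nat.reduceAdd] at hc
    omega
  · simp [h, not_le.mp h]

theorem choose_le_triangularExponent (hk : 1 ≤ k) (n : Fin k → ℕ) :
    ((∑ i, n i) + 1).choose 2 ≤ triangularExponent n := by
  have := Finset.single_le_sum
    (f := fun i : Fin k => ((∑ l ∈ Finset.Ici i, n l) + 1).choose 2) (fun _ _ => Nat.zero_le _)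
    (Finset.mem_univ (⟨0, hk⟩ : Fin k))
  have h0 : Finset.Ici (⟨0, hk⟩ : Fin k) = Finset.univ := by
    ext i; simp [Fin.le_def]
  simpa [h0, triangularExponent] using this

theorem partCount_le (n : Fin k → ℕ) : partCount n ≤ k * ∑ i, n i := by
  rw [partCount, Finset.mul_sum]
  exact Finset.sum_le_sum fun i _ => Nat.mul_le_mul_right _ i.2

theorem excessExponent_le (n : Fin k → ℕ) : excessExponent n ≤ k * ∑ i, n i := by
  rw [excessExponent, Finset.mul_sum]
  exact Finset.sum_le_sum fun i _ => Nat.mul_le_mul_right _ i.2.le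

end Statistics

/-! ### The functional equation and its iteration -/

section FunctionalEquation

variable {k : ℕ}

theorem aeval_geomPoly_mul (q : ℂ) (e : ℕ) :
    aeval q (geomPoly (e : ℤ)) * (1 - q) = 1 - q * q ^ e := by
  have h : ((e : ℤ) + 1).toNat = e + 1 := by omega
  rw [geomPoly, h, ← pow_succ', ← geom_sum_mul_neg]
  simp

theorem qPoch_add (a q : ℂ) (M j : ℕ) :
    qPoch a q (M + j) = qPoch a q M * ∏ i ∈ Finset.range j, (1 - a * q ^ (M + i)) := by
  simp [qPoch, Finset.prod_range_add]

/-- With `i = j + 1 - r` the top exponents are `M + i ≥ 0`. The result is the first `j` of the `j +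
1` factors by which `(q;q)_M` grows to `(q;q)_(M+j+1)`; the last one is `1 - q^N`. -/
theorem prod_geomPoly (q : ℂ) (M j : ℕ) :
    (∏ r ∈ Finset.Icc 2 (j + 1), aeval q (geomPoly (((M + (j + 1) : ℕ) : ℤ) - (r : ℤ)))) *
      (1 - q) ^ j = ∏ i ∈ Finset.range j, (1 - q * q ^ (M + i)) := by
  have h : ∏ r ∈ Finset.Icc 2 (j + 1), aeval q (geomPoly (((M + (j + 1) : ℕ) : ℤ) - (r : ℤ))) =
      ∏ i ∈ Finset.range j, aeval q (geomPoly ((M + i : ℕ) : ℤ)) := by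
    refine Finset.prod_nbij' (fun r => j + 1 - r) (fun i => j + 1 - i) ?_ ?_ ?_ ?_ ?_
    · intro r hr
      simp only [Finset.mem_Icc, Finset.mem_range] at *
      omega
    · intro r hr
      simp only [Finset.mem_Icc, Finset.mem_range] at *
      omega
    · intro r hr
      simp only [Finset.mem_Icc] at *
      omega
    · intro r hr
      simp only [Finset.mem_range] at *
      omega
    · intro r hr
      simp only [Finset.mem_Icc] at hr
      congr 2
      omega
  rw [h, ← Finset.card_range j, ← Finset.prod_const, Finset.card_range,
    ← Finset.prod_mul_distrib]
  exact Finset.prod_congr rfl fun i _ => aeval_geomPoly_mul q _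

theorem one_sub_mul_pow_ne_zero {q : ℂ} (hq : ‖q‖ < 1) (m : ℕ) : 1 - q * q ^ m ≠ 0 := by
  intro h
  have h1 : q ^ (m + 1) = 1 := by rw [pow_succ']; exact (sub_eq_zero.mp h).symm
  have h2 : ‖q‖ ^ (m + 1) = 1 := by rw [← norm_pow, h1, norm_one]
  exact absurd h2 (pow_lt_one₀ (norm_nonneg q) hq (Nat.succ_ne_zero m)).ne

theorem qPoch_self_ne_zero {q : ℂ} (hq : ‖q‖ < 1) (n : ℕ) : qPoch q q n ≠ 0 :=
  Finset.prod_ne_zero_iff.mpr fun m _ => one_sub_mul_pow_ne_zero hq m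

theorem regularTerm_mul_right (b : (Fin k → ℤ) → ℤ[X]) (x q : ℂ) (n : Fin k → ℕ) :
    regularTerm b (x * q) q n = q ^ partCount n * regularTerm b x q n := by
  simp only [regularTerm, mul_pow]
  ring

/-- The summand of the functional equation that comes from lowering the entry `j` by one. -/
noncomputable def loweredTerm (b : (Fin k → ℤ) → ℤ[X]) (x q : ℂ) (j : Fin k) (n : Fin k → ℕ) :
    ℂ :=
  if 1 ≤ n j then x ^ ((j : ℕ) + 1) * regularTerm b x q (n - Pi.single j 1) else 0

theorem loweredTerm_add_single (b : (Fin k → ℤ) → ℤ[X]) (x q : ℂ) (j : Fin k) (m : Fin k → ℕ) :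
    loweredTerm b x q j (m + Pi.single j 1) = x ^ ((j : ℕ) + 1) * regularTerm b x q m := by
  simp [loweredTerm]

theorem exists_eq_add_single {n : Fin k → ℕ} {j : Fin k} (h : 1 ≤ n j) :
    ∃ m : Fin k → ℕ, n = m + Pi.single j 1 := by
  refine ⟨n - Pi.single j 1, (tsub_add_cancel_of_le ?_).symm⟩
  intro i
  by_cases hi : i = j
  · subst hi; simpa using h
  · simp [hi]

theorem recurrence_summand {b : (Fin k → ℤ) → ℤ[X]} (hb : IsRegularCoeff k b) {q : ℂ}
    (hq : ‖q‖ < 1) (x : ℂ) (n : Fin k → ℕ) (j : Fin k) :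
    (1 - q ^ partCount n) * (q ^ triangularExponent n * (1 - q) ^ excessExponent n /
        qPoch q q (partCount n) * x ^ partCount n *
      aeval q ((∏ r ∈ Finset.Icc 2 ((j : ℕ) + 1),
          geomPoly (partCountInt (fun i => (n i : ℤ)) - (r : ℤ))) *
        X ^ (∑ i ∈ Finset.Ioi j, ((i : ℤ) - (j : ℤ)) * (n i : ℤ)).toNat *
        b ((fun i => (n i : ℤ)) - Pi.single j 1))) = loweredTerm b (x * q) q j n := by
  by_cases h : 1 ≤ n j
  · obtain ⟨m, rfl⟩ := exists_eq_add_single h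
    have hcast : (fun i => ((m + Pi.single j 1 : Fin k → ℕ) i : ℤ)) - Pi.single j 1 =
        fun i => (m i : ℤ) := by
      funext i
      by_cases hi : i = j
      · subst hi; simp
      · simp [hi]
    rw [loweredTerm_add_single, regularTerm_mul_right, hcast, partCountInt_natCast, toNat_sum_Ioi]
    have htri := triangularExponent_add_single m j
    set t := triangularExponent (m + Pi.single j 1)
    set E := ∑ i ∈ Finset.Ioi j, ∑ l ∈ Finset.Ici i, (m + Pi.single j 1 : Fin k → ℕ) l
    rw [partCount_add_single] at *
    rw [excessExponent_add_single, regularTerm]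
    have hprod := prod_geomPoly q (partCount m) j
    have hpow : q ^ t * q ^ E =
        q ^ triangularExponent m * q ^ (partCount m + ((j : ℕ) + 1)) := by
      rw [← pow_add, ← pow_add, htri]
    have hne := qPoch_self_ne_zero hq (partCount m)
    have hne' := qPoch_self_ne_zero hq (partCount m + ((j : ℕ) + 1))
    have hsplit := qPoch_add q q (partCount m) (j + 1)
    rw [Finset.prod_range_succ] at hsplit
    simp only [map_mul, map_prod, map_pow, aeval_X]
    set G := ∏ r ∈ Finset.Icc 2 ((j : ℕ) + 1),
      aeval q (geomPoly (((partCount m + ((j : ℕ) + 1) : ℕ) : ℤ) - (r : ℤ)))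
    set P := ∏ i ∈ Finset.range (j : ℕ), (1 - q * q ^ (partCount m + i))
    set B := aeval q (b fun i => (m i : ℤ))
    have hfac : 1 - q ^ (partCount m + ((j : ℕ) + 1)) = 1 - q * q ^ (partCount m + (j : ℕ)) := by
      ring
    rw [← hprod, ← hfac] at hsplit
    have hone : (1 - q ^ (partCount m + ((j : ℕ) + 1))) * (G * (1 - q) ^ (j : ℕ)) /
        qPoch q q (partCount m + ((j : ℕ) + 1)) = 1 / qPoch q q (partCount m) := by
      rw [div_eq_div_iff hne' hne, hsplit]
      ring
    calc _ = ((1 - q ^ (partCount m + ((j : ℕ) + 1))) * (G * (1 - q) ^ (j : ℕ)) /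
          qPoch q q (partCount m + ((j : ℕ) + 1))) * (q ^ t * q ^ E) *
          ((1 - q) ^ excessExponent m * x ^ (partCount m + ((j : ℕ) + 1)) * B) := by ring
      _ = _ := by
        rw [hone, hpow]
        ring
  -- When `n j = 0`, lowering leaves the nonnegative range, so both sides vanish.
  · have hneg : b ((fun i => (n i : ℤ)) - Pi.single j 1) = 0 := by
      refine hb.neg _ ⟨j, ?_⟩
      simp
      omega
    simp [hneg, loweredTerm, h]

theorem regularTerm_sub {b : (Fin k → ℤ) → ℤ[X]} (hb : IsRegularCoeff k b) {q : ℂ}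
    (hq : ‖q‖ < 1) (x : ℂ) (n : Fin k → ℕ) :
    regularTerm b x q n - regularTerm b (x * q) q n = ∑ j, loweredTerm b (x * q) q j n := by
  by_cases h0 : n = 0
  · subst h0
    simp [regularTerm_mul_right, partCount, loweredTerm]
  · have hrec := hb.recurrence (fun i => (n i : ℤ)) (fun i => Int.natCast_nonneg _) (by
      intro h
      apply h0
      funext i
      have := congrFun h i
      simpa using this)
    rw [regularTerm_mul_right, ← one_sub_mul, regularTerm, hrec, map_sum, Finset.mul_sum,
      Finset.mul_sum]
    exact Finset.sum_congr rfl fun j _ => recurrence_summand hb hq x n j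

theorem hasSum_loweredTerm {b : (Fin k → ℤ) → ℤ[X]} {x q : ℂ} (j : Fin k)
    (hs : Summable (regularTerm b x q)) :
    HasSum (loweredTerm b x q j) (x ^ ((j : ℕ) + 1) * ∑' n, regularTerm b x q n) := by
  have hinj : Function.Injective fun m : Fin k → ℕ => m + Pi.single j 1 :=
    add_left_injective _
  rw [← hinj.hasSum_iff]
  · have hcomp : loweredTerm b x q j ∘ (fun m : Fin k → ℕ => m + Pi.single j 1) =
        fun m => x ^ ((j : ℕ) + 1) * regularTerm b x q m :=
      funext fun m => loweredTerm_add_single b x q j m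
    rw [hcomp]
    exact hs.hasSum.mul_left _
  · intro n hn
    refine if_neg fun h => hn ?_
    obtain ⟨m, rfl⟩ := exists_eq_add_single h
    exact ⟨m, rfl⟩

theorem tsum_regularTerm_eq {b : (Fin k → ℤ) → ℤ[X]} (hb : IsRegularCoeff k b) {q : ℂ}
    (hq : ‖q‖ < 1) (x : ℂ) (hs : Summable (regularTerm b x q))
    (hs' : Summable (regularTerm b (x * q) q)) :
    ∑' n, regularTerm b x q n =
      (∑ i ∈ Finset.range (k + 1), (x * q) ^ i) * ∑' n, regularTerm b (x * q) q n := by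
  have h1 := hs.hasSum.sub hs'.hasSum
  have h2 := hasSum_sum (s := Finset.univ) fun j (_ : j ∈ Finset.univ) =>
    hasSum_loweredTerm (b := b) (x := x * q) (q := q) j hs'
  simp only [regularTerm_sub hb hq] at h1
  have h3 := h1.unique h2
  -- The lowered terms account for the powers `1, …, k` of `xq`; the power `0` is `F(xq)` moved
  -- across the equation.
  rw [Finset.sum_range_succ', add_mul, Finset.sum_mul, Finset.sum_range, ← h3]
  ring

theorem qPoch_mul_tsum {b : (Fin k → ℤ) → ℤ[X]} (hb : IsRegularCoeff k b) {q : ℂ}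
    (hq : ‖q‖ < 1) (x : ℂ) (hs : ∀ x, Summable (regularTerm b x q)) (M : ℕ) :
    (∑' n, regularTerm b x q n) * qPoch (x * q) q M =
      qPoch (x ^ (k + 1) * q ^ (k + 1)) (q ^ (k + 1)) M *
        ∑' n, regularTerm b (x * q ^ M) q n := by
  induction M with
  | zero => simp [qPoch]
  | succ M ih =>
    have hgeom := geom_sum_mul_neg (x * q ^ M * q) (k + 1)
    have hstep := tsum_regularTerm_eq hb hq (x * q ^ M) (hs _) (hs _)
    simp only [qPoch, Finset.prod_range_succ] at *
    rw [← mul_assoc, ih, hstep, pow_succ q M, ← mul_assoc x]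
    have e1 : 1 - x * q * q ^ M = 1 - x * q ^ M * q := by ring
    have e2 : 1 - x ^ (k + 1) * q ^ (k + 1) * (q ^ (k + 1)) ^ M =
      1 - (x * q ^ M * q) ^ (k + 1) := by
      rw [mul_pow, mul_pow, pow_right_comm q]; ring
    rw [e1, e2, ← hgeom]
    ring

end FunctionalEquation

/-! ### Absolute convergence and the limits -/

section Convergence

variable {k : ℕ}

theorem norm_aeval_geomPoly_le {q : ℂ} (hq : ‖q‖ < 1) (e : ℤ) :
    ‖aeval q (geomPoly e)‖ ≤ (1 - ‖q‖)⁻¹ := by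
  rw [← tsum_geometric_of_lt_one (norm_nonneg q) hq, geomPoly, map_sum]
  refine (norm_sum_le _ _).trans ?_
  simp only [map_pow, aeval_X, norm_pow]
  exact (summable_geometric_of_lt_one (norm_nonneg q) hq).sum_le_tsum _
    fun _ _ => pow_nonneg (norm_nonneg q) _

theorem one_le_inv_one_sub_norm {q : ℂ} (hq : ‖q‖ < 1) : 1 ≤ (1 - ‖q‖)⁻¹ :=
  (one_le_inv₀ (by linarith)).mpr (by linarith [norm_nonneg q])

/-- One step of the recurrence has `k` summands, each with fewer than `k` geometric factors bounded
by `(1 - ‖q‖)⁻¹` and a power of `q` of norm at most `1`. -/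
theorem IsRegularCoeff.norm_aeval_le {b : (Fin k → ℤ) → ℤ[X]} (hb : IsRegularCoeff k b) {q : ℂ}
    (hq : ‖q‖ < 1) (s : ℕ) (n : Fin k → ℤ) (hn : (∑ i, n i).toNat = s) :
    ‖aeval q (b n)‖ ≤ (k * (1 - ‖q‖)⁻¹ ^ k) ^ s := by
  have hC := one_le_inv_one_sub_norm hq
  have hC0 : 0 ≤ (1 - ‖q‖)⁻¹ := zero_le_one.trans hC
  induction s generalizing n with
  | zero =>
    by_cases h : ∀ i, 0 ≤ n i
    · by_cases h0 : n = 0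
      · simp [h0, hb.zero]
      · have := sum_pos_of_ne_zero n h h0
        omega
    · push Not at h
      simp [hb.neg n h]
  | succ s ih =>
    by_cases h : ∀ i, 0 ≤ n i
    · have h0 : n ≠ 0 := by
        rintro rfl
        simp at hn
      rw [hb.recurrence n h h0, map_sum]
      refine (norm_sum_le _ _).trans ?_
      have hbound : ∀ j ∈ (Finset.univ : Finset (Fin k)), ‖aeval q
          ((∏ r ∈ Finset.Icc 2 ((j : ℕ) + 1), geomPoly (partCountInt n - (r : ℤ))) *
            X ^ (∑ i ∈ Finset.Ioi j, ((i : ℤ) - (j : ℤ)) * n i).toNat *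
            b (n - Pi.single j 1))‖ ≤
          (1 - ‖q‖)⁻¹ ^ k * (k * (1 - ‖q‖)⁻¹ ^ k) ^ s := by
        intro j _
        have hprev := ih (n - Pi.single j 1) (by rw [sum_sub_single]; omega)
        rw [map_mul, map_mul, map_prod, map_pow, aeval_X, norm_mul, norm_mul, norm_prod, norm_pow]
        have hprod : ∏ r ∈ Finset.Icc 2 ((j : ℕ) + 1),
            ‖aeval q (geomPoly (partCountInt n - (r : ℤ)))‖ ≤ (1 - ‖q‖)⁻¹ ^ k := by
          refine (Finset.prod_le_prod (fun _ _ => norm_nonneg _)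
            fun r _ => norm_aeval_geomPoly_le hq _).trans ?_
          rw [Finset.prod_const, Nat.card_Icc]
          exact pow_le_pow_right₀ hC (by omega)
        refine mul_le_mul ?_ hprev (norm_nonneg _) (by positivity)
        exact (mul_le_of_le_one_right (Finset.prod_nonneg fun _ _ => norm_nonneg _)
          (pow_le_one₀ (norm_nonneg q) hq.le)).trans hprod
      refine (Finset.sum_le_sum hbound).trans_eq ?_
      rw [Finset.sum_const, Finset.card_univ, Fintype.card_fin, nsmul_eq_mul, pow_succ']
      ring
    · push Not at h
      rw [hb.neg n h, map_zero, norm_zero]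
      positivity

theorem inv_norm_qPoch_self_le {q : ℂ} (hq : ‖q‖ < 1) (n : ℕ) :
    ‖qPoch q q n‖⁻¹ ≤ (1 - ‖q‖)⁻¹ ^ n := by
  have h1 : 0 < 1 - ‖q‖ := by linarith
  rw [inv_pow]
  refine inv_anti₀ (pow_pos h1 n) ?_
  rw [qPoch, norm_prod, ← Finset.card_range n, ← Finset.prod_const, Finset.card_range]
  refine Finset.prod_le_prod (fun _ _ => h1.le) fun i _ => ?_
  have h2 := norm_sub_norm_le (1 : ℂ) (q * q ^ i)
  have h3 : ‖q * q ^ i‖ ≤ ‖q‖ := by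
    rw [norm_mul, norm_pow]
    exact mul_le_of_le_one_right (norm_nonneg q) (pow_le_one₀ (norm_nonneg q) hq.le)
  rw [norm_one] at h2
  linarith

theorem summable_half_pow_sum (k : ℕ) :
    Summable fun n : Fin k → ℕ => (1 / 2 : ℝ) ^ ∑ i, n i := by
  induction k with
  | zero => exact Summable.of_finite
  | succ k ih =>
    rw [← (Fin.consEquiv fun _ : Fin (k + 1) => ℕ).summable_iff]
    have h := Summable.mul_of_nonneg summable_geometric_two ih (fun _ => by positivity)
      (fun _ => by positivity)
    refine h.congr fun p => ?_
    simp [Fin.consEquiv, Fin.sum_univ_succ, pow_add]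

theorem summable_pow_choose_mul_pow {r : ℝ} (h0 : 0 ≤ r) (h1 : r < 1) (A : ℝ) :
    Summable fun s : ℕ => r ^ (s + 1).choose 2 * A ^ s := by
  have ht : Filter.Tendsto (fun s : ℕ => ‖r ^ (s + 1) * A‖) Filter.atTop (nhds 0) := by
    have := ((tendsto_pow_atTop_nhds_zero_of_lt_one h0 h1).comp
      (Filter.tendsto_add_atTop_nat 1)).mul_const A
    simpa using this.norm
  refine summable_of_ratio_norm_eventually_le (r := 1 / 2) (by norm_num) ?_
  filter_upwards [ht.eventually_le_const (show (0 : ℝ) < 1 / 2 by norm_num)] with s hs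
  have hc := Nat.choose_succ_succ' (s + 1) 1
  simp only [Nat.choose_one_right, Nat.reduceAdd] at hc
  have he : r ^ (s + 1 + 1).choose 2 * A ^ (s + 1) =
      (r ^ (s + 1) * A) * (r ^ (s + 1).choose 2 * A ^ s) := by
    rw [show s + 1 + 1 = s + 2 from rfl, hc, pow_add, pow_succ]
    ring
  rw [he, norm_mul]
  exact mul_le_mul_of_nonneg_right hs (norm_nonneg _)

theorem norm_regularTerm_le (hk : 1 ≤ k) {b : (Fin k → ℤ) → ℤ[X]} (hb : IsRegularCoeff k b)
    {q : ℂ} (hq : ‖q‖ < 1) (x : ℂ) (n : Fin k → ℕ) :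
    ‖regularTerm b x q n‖ ≤ ‖q‖ ^ ((∑ i, n i) + 1).choose 2 *
      (2 ^ k * (1 - ‖q‖)⁻¹ ^ k * max 1 ‖x‖ ^ k * (k * (1 - ‖q‖)⁻¹ ^ k)) ^ ∑ i, n i := by
  have hC := one_le_inv_one_sub_norm hq
  have hC0 : 0 ≤ (1 - ‖q‖)⁻¹ := zero_le_one.trans hC
  have hcoeff := hb.norm_aeval_le hq (∑ i, n i) (fun i => (n i : ℤ)) (by
    rw [← Nat.cast_sum, Int.toNat_natCast])
  have hq' : ‖q‖ ^ triangularExponent n ≤ ‖q‖ ^ ((∑ i, n i) + 1).choose 2 :=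
    pow_le_pow_of_le_one (norm_nonneg q) hq.le (choose_le_triangularExponent hk n)
  have h2 : ‖1 - q‖ ^ excessExponent n ≤ 2 ^ (k * ∑ i, n i) := by
    have : ‖1 - q‖ ≤ 2 := (norm_sub_le _ _).trans (by rw [norm_one]; linarith)
    exact (pow_le_pow_left₀ (norm_nonneg _) this _).trans
      (pow_le_pow_right₀ one_le_two (excessExponent_le n))
  have h3 : ‖qPoch q q (partCount n)‖⁻¹ ≤ (1 - ‖q‖)⁻¹ ^ (k * ∑ i, n i) :=
    (inv_norm_qPoch_self_le hq _).trans (pow_le_pow_right₀ hC (partCount_le n))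
  have h4 : ‖x‖ ^ partCount n ≤ max 1 ‖x‖ ^ (k * ∑ i, n i) :=
    (pow_le_pow_left₀ (norm_nonneg x) (le_max_right 1 _) _).trans
      (pow_le_pow_right₀ (le_max_left 1 _) (partCount_le n))
  rw [regularTerm, norm_mul, norm_mul, norm_div, norm_mul, norm_pow, norm_pow, norm_pow,
    div_eq_mul_inv]
  calc _ ≤ ‖q‖ ^ ((∑ i, n i) + 1).choose 2 * 2 ^ (k * ∑ i, n i) *
        (1 - ‖q‖)⁻¹ ^ (k * ∑ i, n i) * max 1 ‖x‖ ^ (k * ∑ i, n i) *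
        (k * (1 - ‖q‖)⁻¹ ^ k) ^ ∑ i, n i := by gcongr
    _ = _ := by
      simp only [mul_pow, pow_mul]
      ring

theorem summable_regularTerm (hk : 1 ≤ k) {b : (Fin k → ℤ) → ℤ[X]} (hb : IsRegularCoeff k b)
    {q : ℂ} (hq : ‖q‖ < 1) (x : ℂ) : Summable (regularTerm b x q) := by
  set A := 2 ^ k * (1 - ‖q‖)⁻¹ ^ k * max 1 ‖x‖ ^ k * (k * (1 - ‖q‖)⁻¹ ^ k) with hA
  -- The base is doubled so that a spare factor `(1/2)^s`, with `s` the entry sum, remains; it is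
  -- summable over all tuples, so tuples of a given sum need not be counted.
  obtain ⟨K, hK⟩ := (summable_pow_choose_mul_pow (norm_nonneg q) hq
    (2 * A)).tendsto_atTop_zero.bddAbove_range
  refine Summable.of_norm_bounded ((summable_half_pow_sum k).mul_left K) fun n => ?_
  refine (norm_regularTerm_le hk hb hq x n).trans ?_
  rw [← hA]
  have h := hK ⟨∑ i, n i, rfl⟩
  simp only [mul_pow] at h
  calc _ = (‖q‖ ^ ((∑ i, n i) + 1).choose 2 * (2 ^ (∑ i, n i) * A ^ (∑ i, n i))) *
        (1 / 2) ^ ∑ i, n i := by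
        rw [one_div, inv_pow]
        field_simp
    _ ≤ _ := mul_le_mul_of_nonneg_right h (by positivity)

/-- Each term at `x q^M` is `(q^M)^N` times the term at `x`: it is dominated by the latter and tends
to `0` unless `n = 0`. -/
theorem tendsto_tsum_regularTerm (hk : 1 ≤ k) {b : (Fin k → ℤ) → ℤ[X]} (hb : IsRegularCoeff k b)
    {q : ℂ} (hq : ‖q‖ < 1) (x : ℂ) :
    Filter.Tendsto (fun M : ℕ => ∑' n, regularTerm b (x * q ^ M) q n) Filter.atTop (nhds 1) := by
  have hmul : ∀ (M : ℕ) (n : Fin k → ℕ),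
      regularTerm b (x * q ^ M) q n = (q ^ M) ^ partCount n * regularTerm b x q n := by
    intro M n
    simp only [regularTerm, mul_pow]
    ring
  have hlim : ∑' n : Fin k → ℕ, (if n = 0 then (1 : ℂ) else 0) = 1 := by
    rw [tsum_ite_eq]
  rw [← hlim]
  refine tendsto_tsum_of_dominated_convergence (summable_regularTerm hk hb hq x).norm ?_ ?_
  · intro n
    by_cases h0 : n = 0
    · subst h0
      have h1 : ∀ y, regularTerm b y q 0 = 1 := by
        intro y
        have : (fun i : Fin k => (((0 : Fin k → ℕ) i : ℕ) : ℤ)) = 0 := by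
          funext i; simp
        rw [regularTerm, this, hb.zero]
        simp [triangularExponent, excessExponent, partCount, qPoch]
      simp [h1]
    · have hN : partCount n ≠ 0 := by
        intro h
        apply h0
        funext i
        have := (Finset.sum_eq_zero_iff.mp h) i (Finset.mem_univ i)
        simpa using this
      simp only [hmul, h0, if_false]
      have := ((tendsto_pow_atTop_nhds_zero_of_norm_lt_one hq).pow (partCount n)).mul_const
        (regularTerm b x q n)
      simpa [hN] using this
  · refine Filter.Eventually.of_forall fun M n => ?_
    rw [hmul, norm_mul, norm_pow, norm_pow]
    exact mul_le_of_le_one_left (norm_nonneg _)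
      (pow_le_one₀ (pow_nonneg (norm_nonneg q) M) (pow_le_one₀ (norm_nonneg q) hq.le))

theorem summable_norm_neg_mul_pow (a : ℂ) {q : ℂ} (hq : ‖q‖ < 1) :
    Summable fun j : ℕ => ‖-(a * q ^ j)‖ := by
  simpa using (summable_geometric_of_lt_one (norm_nonneg q) hq).mul_left ‖a‖

theorem multipliable_one_sub_mul_pow (a : ℂ) {q : ℂ} (hq : ‖q‖ < 1) :
    Multipliable fun j : ℕ => 1 - a * q ^ j := by
  simpa only [sub_eq_add_neg] using
    multipliable_one_add_of_summable (summable_norm_neg_mul_pow a hq)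

theorem tendsto_qPoch (a : ℂ) {q : ℂ} (hq : ‖q‖ < 1) :
    Filter.Tendsto (qPoch a q) Filter.atTop (nhds (qPochInf a q)) :=
  (multipliable_one_sub_mul_pow a hq).hasProd.tendsto_prod_nat

theorem qPochInf_ne_zero {a q : ℂ} (hq : ‖q‖ < 1) (h : ∀ j : ℕ, a * q ^ j ≠ 1) :
    qPochInf a q ≠ 0 := by
  simp only [qPochInf, sub_eq_add_neg]
  refine tprod_one_add_ne_zero_of_summable (fun j => ?_) (summable_norm_neg_mul_pow a hq)
  rw [← sub_eq_add_neg]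
  exact sub_ne_zero.mpr (h j).symm

end Convergence

theorem theorem2 (k : ℕ) (hk : 1 ≤ k) :
    (∃! b : (Fin k → ℤ) → ℤ[X], IsRegularCoeff k b) ∧
    ∀ b : (Fin k → ℤ) → ℤ[X], IsRegularCoeff k b →
      ∀ q x : ℂ, ‖q‖ < 1 → (∀ m : ℕ, 1 ≤ m → x * q ^ m ≠ 1) →
        (Multipliable fun j : ℕ => 1 - x ^ (k + 1) * q ^ (k + 1) * (q ^ (k + 1)) ^ j) ∧
        (Multipliable fun j : ℕ => 1 - x * q * q ^ j) ∧
        qPochInf (x * q) q ≠ 0 ∧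
        HasSum (fun n : Fin k → ℕ => regularTerm b x q n)
          (qPochInf (x ^ (k + 1) * q ^ (k + 1)) (q ^ (k + 1)) / qPochInf (x * q) q) := by
  refine ⟨?_, fun b hb q x hq hx => ?_⟩
  · obtain ⟨b, hb⟩ := exists_isRegularCoeff k
    exact ⟨b, hb, fun c hc => hc.ext hb⟩
  · have hqk : ‖q ^ (k + 1)‖ < 1 := by
      rw [norm_pow]
      exact pow_lt_one₀ (norm_nonneg q) hq (Nat.succ_ne_zero k)
    have hne : qPochInf (x * q) q ≠ 0 := qPochInf_ne_zero hq fun j => by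
      rw [mul_assoc, ← pow_succ']
      exact hx _ (Nat.succ_pos j)
    refine ⟨multipliable_one_sub_mul_pow _ hqk, multipliable_one_sub_mul_pow _ hq, hne, ?_⟩
    have hs := summable_regularTerm hk hb hq
    have hleft := (tendsto_qPoch (x * q) hq).const_mul (∑' n, regularTerm b x q n)
    have hright := (tendsto_qPoch (x ^ (k + 1) * q ^ (k + 1)) hqk).mul
      (tendsto_tsum_regularTerm hk hb hq x)
    -- The two limits now concern one sequence, so they agree; division happens only afterwards, by
    -- the nonzero infinite product.
    rw [← funext (qPoch_mul_tsum hb hq x hs)] at hright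
    have heq := tendsto_nhds_unique hleft hright
    rw [mul_one] at heq
    rw [← heq, mul_div_cancel_right₀ _ hne]
    exact (hs x).hasSum
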